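/- Let $E$ be a finite set and let $\mathcal M=(E,\mathcal I)$ be a matroid. For $k\ge 1$, the $k$-fold union $\mathcal M^k$ has as its feasible sets the family $\mathcal I^k=\{I_1\cup\dots\cup I_k : I_1,\dots,I_k\in\mathcal I\}$. For a family $\mathcal F$ of feasible subsets of $E$, let $\mathcal P_{\mathcal F}=\mathrm{conv}\{\mathbf 1_F : F\in\mathcal F\}\subseteq[0,1]^E$. An online contention resolution scheme (OCRS) for $\mathcal F$ takes a vector $x\in\mathcal P_{\mathcal F}$ as input. Each $e\in E$ is active independently with probability $x_e$. The elements arrive one by one and reveal whether they are active; each active element must be accepted or rejected immediately and irrevocably, inactive elements are rejected, and the set of accepted elements must always belong to $\mathcal F$. The scheme may use internal randomness that is independent of the active set. The scheme is $c$-selectable against the almighty adversary if for every $x\in\mathcal P_{\mathcal F}$, every $e\in E$ and every arrival order, chosen adaptively with full knowledge of the active set, of the internal randomness and of the past decisions, $\Pr[e\text{ is accepted}]\ge c\cdot x_e$ (that is, $\Pr[e\text{ is accepted}\mid e\text{ is active}]\ge c$ if $x_e>0$). **Theorem.** There is an absolute constant $C>0$ such that for every $k\ge 2$ and every matroid $\mathcal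 M$ on a finite ground set $E$, the $k$-fold union $\mathcal M^k$ admits an OCRS that is $\bigl(1-C\sqrt{\log k/k}\bigr)$-selectable against the almighty adversary. Moreover, the following scheme has this property. *The scheme.* Let $b=1-\sqrt{\log k/k}$. Let $\mathcal M_*$ be the matroid on $E_*=E\times[k]$ obtained from $\mathcal M$ by replacing each element with $k$ parallel copies (a set $\{(e_1,i_1),\dots,(e_t,i_t)\}$ is independent iff $e_1,\dots,e_t$ are distinct and $\{e_1,\dots,e_t\}\in\mathcal I$), and let $\mathcal M^k_*$ be its $k$-fold union, with rank function $\mathrm{rank}$. For $e\in E$ and $S\subseteq E_*$ let $$\mathrm{occ}_e(S)=k-\mathrm{rank}(S\cup(\{e\}\times[k]))+\mathrm{rank}(S).$$ Given $x\in\mathcal P_{\mathcal I^k}$, let $y\in[0,1]^{E_*}$ be given by $y_{(e,1)}=b\,x_e$ and $y_{(e,i)}=0$ for $i\ne1$. For $B\subseteq E$, let $R_B$ be the random subset of $B\times[k]$ that contains each $a$ independently with probability $y_a$. Starting from $S_0=\emptyset$, as long as there is an $e\in B\setminus S_0$ with $\mathbb E[\mathrm{occ}_e(R_B\cup(S_0\times[k]))]>bk$,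 add one such $e$ to $S_0$; let $\mathrm{Protect}(B)$ be the final $S_0$. Put $B_0=E$, $B_{j+1}=\mathrm{Protect}(B_j)$ and $N_j=B_j\times[k]$. Online, first keep each element independently with probability $b\cdot e^{-(1-b)}$ and reject the others. Accept an active kept element $e\in B_j\setminus B_{j+1}$ if and only if $(e,1)$ is not in the span, in $\mathcal M^k_*$, of $N_{j+1}\cup(A_j\times\{1\})$, where $A_j$ is the set of elements of $B_j\setminus B_{j+1}$ accepted so far. (Elements that lie in all $B_j$ are rejected.) -/

import Mathlib

universe u

/-! ### Independent random subsets -/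

/-- The probability that the random subset of the finite set `N`, containing each `a ∈ N`
independently with probability `p a`, equals `R` (for `R ⊆ N`). -/
noncomputable def subsetProb {α : Type u} [DecidableEq α] (N : Finset α) (p : α → ℝ)
    (R : Finset α) : ℝ :=
  (∏ a ∈ R, p a) * ∏ a ∈ N \ R, (1 - p a)

theorem sum_subsetProb {α : Type u} [DecidableEq α] (N : Finset α) (p : α → ℝ) :
    ∑ R ∈ N.powerset, subsetProb N p R = 1 := by
  unfold subsetProb
  rw [← Finset.prod_add]
  simp

theorem subsetProb_nonneg {α : Type u} [DecidableEq α] (N : Finset α) (p : α → ℝ)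
    (h0 : ∀ a, 0 ≤ p a) (h1 : ∀ a, p a ≤ 1) (R : Finset α) : 0 ≤ subsetProb N p R :=
  mul_nonneg (Finset.prod_nonneg fun a _ => h0 a)
    (Finset.prod_nonneg fun a _ => sub_nonneg.2 (h1 a))

/-! ### Feasible families -/

/-- The polytope of a family of feasible sets: the convex hull of the characteristic vectors. -/
def polytope {α : Type u} (𝓕 : Set (Finset α)) : Set (α → ℝ) :=
  convexHull ℝ ((fun S : Finset α => Set.indicator (S : Set α) 1) '' 𝓕)

/-- The feasible sets of the `k`-fold union of a matroid: the unions of `k` independent sets. -/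
def kFoldUnion {α : Type u} [DecidableEq α] (M : Matroid α) (k : ℕ) : Set (Finset α) :=
  {S | ∃ I : Fin k → Finset α, (∀ i, M.Indep (I i : Set α)) ∧ S = Finset.univ.biUnion I}

open Classical in
/-- The rank of `S`: the largest size of a feasible set contained in `S`. -/
noncomputable def familyRank {α : Type u} (𝓕 : Set (Finset α)) (S : Finset α) : ℕ :=
  (S.powerset.filter (· ∈ 𝓕)).sup Finset.card

/-- `a` is in the span of `S`: adding it to `S` does not change the rank. -/
def InSpan {α : Type u} [DecidableEq α] (𝓕 : Set (Finset α)) (S : Finset α) (a : α) : Prop :=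
  familyRank 𝓕 S = familyRank 𝓕 (insert a S)

/-! ### Online contention resolution schemes -/

/-- An online accept/reject rule on the ground set `E`. The internal randomness `ω` is drawn from a
finite probability space, independently of the active set. When an active element `e` arrives,
`rule ω h A e` says whether it is accepted, where `h` lists the elements that arrived earlier (the
latest first), each with the information whether it was active, and `A` is the set of elements
accepted so far. -/
structure OnlineScheme (E : Type u) where
  Seed : Type u
  [seedFintype : Fintype Seed]
  seedProb : Seed → ℝ
  seedProb_nonneg : ∀ ω, 0 ≤ seedProb ω
  sum_seedProb : ∑ ω, seedProb ω = 1
  rule : Seed → List (E × Bool) → Finset E → E → Prop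

attribute [instance] OnlineScheme.seedFintype

open Classical in
/-- Process the elements of a list in order, with active set `R`, history `h` and accepted set `A`.
Inactive elements are rejected; active ones are accepted exactly if the rule says so. -/
noncomputable def OnlineScheme.runFrom {E : Type u} [DecidableEq E] (σ : OnlineScheme E)
    (ω : σ.Seed) (R : Finset E) : List E → List (E × Bool) → Finset E → Finset E
  | [], _, A => A
  | e :: l, h, A =>
      σ.runFrom ω R l ((e, decide (e ∈ R)) :: h)
        (if e ∈ R ∧ σ.rule ω h A e then insert e A else A)

/-- The output of the scheme for internal randomness `ω`, active set `R` and arrival order `l`. -/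
noncomputable def OnlineScheme.output {E : Type u} [DecidableEq E] (σ : OnlineScheme E)
    (ω : σ.Seed) (R : Finset E) (l : List E) : Finset E :=
  σ.runFrom ω R l [] ∅

/-- Each element of `E` arrives exactly once. -/
def IsArrivalOrder {E : Type u} (l : List E) : Prop :=
  l.Nodup ∧ ∀ e, e ∈ l

/-- An almighty adversary, who knows the active set and the internal randomness of the scheme. The
decisions of the scheme are determined by these and by the order, so that choosing each next
arrival online, given also the past decisions, amounts to choosing an order from these data. -/
structure AlmightyAdversary {E : Type u} (σ : OnlineScheme E) where
  order : Finset E → σ.Seed → List E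
  isArrivalOrder : ∀ R ω, IsArrivalOrder (order R ω)

open Classical in
/-- The probability that `e` is accepted when every `a` is active independently with probability
`x a` and the adversary `𝒜` chooses the order. -/
noncomputable def OnlineScheme.acceptProb {E : Type u} [Fintype E] [DecidableEq E]
    (σ : OnlineScheme E) (x : E → ℝ) (𝒜 : AlmightyAdversary σ) (e : E) : ℝ :=
  ∑ R : Finset E, ∑ ω : σ.Seed, subsetProb Finset.univ x R * σ.seedProb ω *
    (if e ∈ σ.output ω R (𝒜.order R ω) then 1 else 0)

/-- An online contention resolution scheme for `𝓕`: an online rule for each point of the polytope,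
whose output is always feasible. -/
structure OCRS {E : Type u} [DecidableEq E] (𝓕 : Set (Finset E)) where
  scheme : polytope 𝓕 → OnlineScheme E
  feasible : ∀ (x : polytope 𝓕) (ω : (scheme x).Seed) (R : Finset E) (l : List E),
    IsArrivalOrder l → (scheme x).output ω R l ∈ 𝓕

/-- `c`-selectability against the almighty adversary: `Pr[e accepted] ≥ c · x e`, which for
`x e > 0` is `Pr[e accepted | e active] ≥ c`. -/
def OCRS.IsSelectable {E : Type u} [Fintype E] [DecidableEq E] {𝓕 : Set (Finset E)}
    (S : OCRS 𝓕) (c : ℝ) : Prop :=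
  ∀ (x : polytope 𝓕) (𝒜 : AlmightyAdversary (S.scheme x)) (e : E),
    c * (x : E → ℝ) e ≤ (S.scheme x).acceptProb x 𝒜 e

/-! ### The chain decomposition scheme -/

/-- The extended `k`-fold union: the `k`-fold union of the matroid on `E × [k]` obtained from `M` by
replacing each element with `k` parallel copies. -/
def extendedUnion {E : Type u} [DecidableEq E] (M : Matroid E) (k : ℕ) :
    Set (Finset (E × Fin k)) :=
  kFoldUnion (M.comap Prod.fst) k

/-- `B × [k]`. -/
def copies {E : Type u} (k : ℕ) (B : Finset E) : Finset (E × Fin k) :=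
  B ×ˢ Finset.univ

/-- The occupancy function of `e`. -/
noncomputable def occ {E : Type u} [DecidableEq E] (M : Matroid E) (k : ℕ) (e : E)
    (S : Finset (E × Fin k)) : ℝ :=
  k - familyRank (extendedUnion M k) (S ∪ copies k {e}) + familyRank (extendedUnion M k) S

/-- The expected occupancy of `e` by `R ∪ (S₀ × [k])`, where `R` is the random subset of `B × [k]`
that contains each `a` independently with probability `y a`. -/
noncomputable def expectedOcc {E : Type u} [DecidableEq E] (M : Matroid E) (k : ℕ)
    (y : E × Fin k → ℝ) (B S₀ : Finset E) (e : E) : ℝ :=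
  ∑ R ∈ (copies k B).powerset, subsetProb (copies k B) y R * occ M k e (R ∪ copies k S₀)

open Classical in
/-- If some `e ∈ B \ S₀` has expected occupancy larger than `b * k`, add one such `e` to `S₀`. -/
noncomputable def protectStep {E : Type u} [DecidableEq E] (M : Matroid E) (k : ℕ) (b : ℝ)
    (y : E × Fin k → ℝ) (B S₀ : Finset E) : Finset E :=
  if h : ∃ e, e ∈ B \ S₀ ∧ b * k < expectedOcc M k y B S₀ e then insert h.choose S₀ else S₀

/-- The protection set of the extended union restricted to `B × [k]` is `protect M k b y B × [k]`.
The step is repeated until nothing changes, for which `B.card` steps suffice. -/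
noncomputable def protect {E : Type u} [DecidableEq E] (M : Matroid E) (k : ℕ) (b : ℝ)
    (y : E × Fin k → ℝ) (B : Finset E) : Finset E :=
  (protectStep M k b y B)^[B.card] ∅

/-- The chain decomposition `E × [k] = N₀ ⊇ N₁ ⊇ ⋯`, where `N_j = chain M k b y j × [k]`. -/
noncomputable def chain {E : Type u} [Fintype E] [DecidableEq E] (M : Matroid E) (k : ℕ) (b : ℝ)
    (y : E × Fin k → ℝ) : ℕ → Finset E
  | 0 => Finset.univ
  | j + 1 => protect M k b y (chain M k b y j)

/-- The parameter `b = 1 - √(log k / k)`. -/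
noncomputable def scaleParam (k : ℕ) : ℝ :=
  1 - Real.sqrt (Real.log k / k)

theorem scaleParam_le_one (k : ℕ) : scaleParam k ≤ 1 :=
  sub_le_self _ (Real.sqrt_nonneg _)

theorem scaleParam_nonneg (k : ℕ) : 0 ≤ scaleParam k := by
  refine sub_nonneg.2 (Real.sqrt_le_one.2 ?_)
  exact div_le_one_of_le₀ (Real.log_le_self (Nat.cast_nonneg k)) (Nat.cast_nonneg k)

/-- The probability with which an element is kept: a factor `b` for scaling the polytope by `b`, and
the extra factor `e^{-(1-b)}`. -/
noncomputable def keepProb (k : ℕ) : ℝ :=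
  scaleParam k * Real.exp (-(1 - scaleParam k))

theorem keepProb_nonneg (k : ℕ) : 0 ≤ keepProb k :=
  mul_nonneg (scaleParam_nonneg k) (Real.exp_pos _).le

theorem keepProb_le_one (k : ℕ) : keepProb k ≤ 1 :=
  mul_le_one₀ (scaleParam_le_one k) (Real.exp_pos _).le
    (Real.exp_le_one_iff.2 (neg_nonpos.2 (sub_nonneg.2 (scaleParam_le_one k))))

/-- The vector `x` on `E × {first copy} ≅ E`, extended by zero to `E × [k]` and scaled by `b`. -/
noncomputable def liftedVector {E : Type u} (k : ℕ) [NeZero k] (x : E → ℝ) : E × Fin k → ℝ :=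
  fun a => if a.2 = 0 then scaleParam k * x a.1 else 0

/-- The chain decomposition scheme for the `k`-fold union of `M` at `x`, where `E` is identified
with the first copies in `E × [k]`. The seed is the set `K` of kept elements. A kept element `e`
of the layer `N_j \ N_{j+1}` is accepted iff its copy is not in the span of `N_{j+1}` and the
elements of the same layer accepted so far. -/
noncomputable def chainScheme {E : Type u} [Fintype E] [DecidableEq E] (M : Matroid E) (k : ℕ)
    [NeZero k] (x : E → ℝ) : OnlineScheme E where
  Seed := Finset E
  seedProb := subsetProb Finset.univ fun _ => keepProb k
  seedProb_nonneg := subsetProb_nonneg _ _ (fun _ => keepProb_nonneg k) fun _ => keepProb_le_one k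
  sum_seedProb := by
    rw [← sum_subsetProb (Finset.univ : Finset E) fun _ => keepProb k, Finset.powerset_univ]
  rule := fun K _ A e =>
    let N : ℕ → Finset E := chain M k (scaleParam k) (liftedVector k x)
    e ∈ K ∧ ∃ j, e ∈ N j \ N (j + 1) ∧
      ¬ InSpan (extendedUnion M k)
        ((A ∩ (N j \ N (j + 1))) ×ˢ {(0 : Fin k)} ∪ copies k (N (j + 1))) (e, 0)

/-!
The accepted set of the chain decomposition scheme is feasible because, layer by layer, each
accepted element is outside the span of the later layers and of the elements of its own layer
accepted before it (`mem_kFoldUnion_of_layers`). This uses that the `k`-fold union is a matroid, and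
so has a submodular rank function (`kFoldUnion_augment`, `familyRank_inter_add_union_le`).

Selectability rests on a concentration inequality. For a monotone set function `f` with marginals at
most `1`, let `R` contain each `a` independently with probability `p a`, and let `R'` be obtained
from `R` by thinning with the factor `exp (-l)`. Then `E[exp (l f(R'))] ≤ exp (l E[f(R)])`
(`subsetExp_exp_le`). The proof conditions on one coordinate at a time and uses only
`1 + p e^{-l} (e^{l d} - 1) ≤ e^{l p d}` for `0 ≤ d ≤ 1`.

An element `e` of the layer `N_j \ N_{j+1}` is unprotected, so the expectation of its occupancy by
the random set and `N_{j+1}` is at most `b k`. The occupancy is monotone with marginals at most `1`,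
and the keep probability `b e^{-(1-b)}` thins the random set by `e^{-l}` with `l = 1 - b`. So by
Markov's inequality, `e` is fully occupied with probability at most `exp (-(1 - b)² k) = 1 / k`
(`subsetExp_layerOcc_le`). If it is not fully occupied even when all other active kept elements of
its layer are present, then it is accepted in every arrival order (`mem_chainScheme_output`). Here
the copies of `e` are interchangeable, so spanning one of them means spanning all
(`occ_eq_of_inSpan`). Altogether `e` is accepted with probability at least
`b e^{-(1-b)} (1 - 1/k) x e`, which is at least `(1 - 3 √(log k / k)) x e`.

Finally, every `e` with `x e ≠ 0` lies in some layer (`exists_mem_layer`). If the protection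
procedure exhausted a set `B` of positive rank `ρ`, then the rank `k ρ` of `B × [k]` would be less
than the sum of `b x(B) ≤ b k ρ`, from the random set, and `(1 - b) k ρ`, from the at most `ρ` steps
that raise the rank, each by less than `(1 - b) k` in expectation (`eq_zero_of_protect_eq`).
-/

/-! ### The union of matroids -/

theorem mem_kFoldUnion_iff_exists_coloring {α : Type u} [DecidableEq α] {M : Matroid α} {k : ℕ}
    [NeZero k] {S : Finset α} :
    S ∈ kFoldUnion M k ↔
      ∃ c : α → Fin k, ∀ i, M.Indep (S.filter (c · = i) : Finset α) := by
  constructor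
  · rintro ⟨I, hI, rfl⟩
    have h : ∀ a, ∃ i : Fin k, a ∈ Finset.univ.biUnion I → a ∈ I i := by
      intro a
      by_cases ha : a ∈ Finset.univ.biUnion I
      · obtain ⟨i, -, hi⟩ := Finset.mem_biUnion.1 ha
        exact ⟨i, fun _ => hi⟩
      · exact ⟨0, fun h => absurd h ha⟩
    choose c hc using h
    refine ⟨c, fun i => (hI i).subset ?_⟩
    intro a ha
    obtain ⟨h1, rfl⟩ := Finset.mem_filter.1 (Finset.mem_coe.1 ha)
    exact hc a h1
  · rintro ⟨c, hc⟩
    refine ⟨fun i => S.filter (c · = i), hc, ?_⟩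
    ext a
    simp

theorem empty_mem_kFoldUnion {α : Type u} [DecidableEq α] (M : Matroid α) (k : ℕ) :
    ∅ ∈ kFoldUnion M k :=
  ⟨fun _ => ∅, fun _ => by simp, by ext; simp⟩

theorem kFoldUnion_subset {α : Type u} [DecidableEq α] {M : Matroid α} {k : ℕ} {S T : Finset α}
    (hT : T ∈ kFoldUnion M k) (h : S ⊆ T) : S ∈ kFoldUnion M k := by
  obtain ⟨I, hI, rfl⟩ := hT
  refine ⟨fun i => I i ∩ S, fun i => (hI i).subset (by simp), ?_⟩
  ext a
  constructor
  · intro ha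
    obtain ⟨i, -, hi⟩ := Finset.mem_biUnion.1 (h ha)
    exact Finset.mem_biUnion.2 ⟨i, Finset.mem_univ _, Finset.mem_inter.2 ⟨hi, ha⟩⟩
  · intro ha
    obtain ⟨i, -, hi⟩ := Finset.mem_biUnion.1 ha
    exact (Finset.mem_inter.1 hi).2

/-- The augmentation property of the matroid union. Fix a colouring `d` of `J` and choose the
colouring `c` of `I` to agree with `d` as often as possible. Some colour class of `J` is larger than
that of `I`, so the latter can be augmented by some `e ∈ J` of this colour. If `e` were in `I`, then
recolouring it would increase the agreement. -/
theorem kFoldUnion_augment {α : Type u} [DecidableEq α] {M : Matroid α} {k : ℕ} [NeZero k]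
    {I J : Finset α} (hI : I ∈ kFoldUnion M k) (hJ : J ∈ kFoldUnion M k) (hIJ : I.card < J.card) :
    ∃ e ∈ J, e ∉ I ∧ insert e I ∈ kFoldUnion M k := by
  obtain ⟨c, hc⟩ := mem_kFoldUnion_iff_exists_coloring.1 hI
  obtain ⟨d, hd⟩ := mem_kFoldUnion_iff_exists_coloring.1 hJ
  induction hn : J.card - (J.filter fun a => c a = d a).card using Nat.strong_induction_on
    generalizing c with
  | _ n ih =>
    obtain ⟨i, hi⟩ : ∃ i, (I.filter (c · = i)).card < (J.filter (d · = i)).card := by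
      by_contra! h
      refine hIJ.not_ge ?_
      rw [Finset.card_eq_sum_card_fiberwise (f := d) (t := Finset.univ) (by simp),
        Finset.card_eq_sum_card_fiberwise (f := c) (t := Finset.univ) (by simp)]
      exact Finset.sum_le_sum fun i _ => h i
    obtain ⟨e, he, hins⟩ := (hc i).exists_insert_of_encard_lt (hd i) (by
      simpa only [Set.encard_coe_eq_coe_finsetCard, Nat.cast_lt] using hi)
    have heJ : e ∈ J ∧ d e = i := by simpa using he.1
    have heI : ¬ (e ∈ I ∧ c e = i) := by simpa using he.2
    have hc' : ∀ l, M.Indep ((insert e I).filter (Function.update c e i · = l) : Finset α) := by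
      intro l
      by_cases hl : l = i
      · subst hl
        refine hins.subset fun a ha => ?_
        have ha' := Finset.mem_filter.1 (Finset.mem_coe.1 ha)
        by_cases hae : a = e
        · simp [hae]
        · have := ha'.2
          rw [Function.update_of_ne hae] at this
          have h2 := Finset.mem_of_mem_insert_of_ne ha'.1 hae
          simp [h2, this]
      · refine (hc l).subset fun a ha => ?_
        have ha' := Finset.mem_filter.1 (Finset.mem_coe.1 ha)
        have hae : a ≠ e := by
          rintro rfl
          have := ha'.2
          rw [Function.update_self] at this
          exact hl this.symm
        have := ha'.2
        rw [Function.update_of_ne hae] at this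
        have h2 := Finset.mem_of_mem_insert_of_ne ha'.1 hae
        simp [h2, this]
    by_cases heI' : e ∈ I
    · rw [Finset.insert_eq_of_mem heI'] at hc'
      refine ih _ ?_ (Function.update c e i) hc' rfl
      have hlt : (J.filter fun a => c a = d a).card <
          (J.filter fun a => Function.update c e i a = d a).card := by
        refine Finset.card_lt_card (Finset.ssubset_iff_subset_ne.2 ⟨fun a ha => ?_, fun h => ?_⟩)
        · obtain ⟨h1, h2⟩ := Finset.mem_filter.1 ha
          refine Finset.mem_filter.2 ⟨h1, ?_⟩
          rcases eq_or_ne a e with rfl | hae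
          · rw [Function.update_self, heJ.2]
          · rwa [Function.update_of_ne hae]
        · have : e ∈ J.filter fun a => Function.update c e i a = d a :=
            Finset.mem_filter.2 ⟨heJ.1, by rw [Function.update_self, heJ.2]⟩
          rw [← h] at this
          exact heI ⟨heI', (Finset.mem_filter.1 this).2.trans heJ.2⟩
      have hle : (J.filter fun a => Function.update c e i a = d a).card ≤ J.card :=
        Finset.card_filter_le _ _
      omega
    · exact ⟨e, heJ.1, heI', mem_kFoldUnion_iff_exists_coloring.2 ⟨_, hc'⟩⟩

/-- The `k`-fold union as a matroid on all of `α`. -/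
noncomputable def unionMatroid {α : Type u} [DecidableEq α] (M : Matroid α) (k : ℕ) [NeZero k] :
    Matroid α :=
  (IndepMatroid.ofFinset Set.univ (· ∈ kFoldUnion M k) (empty_mem_kFoldUnion M k)
    (fun _ _ => kFoldUnion_subset) (fun _ _ => kFoldUnion_augment)
    (fun _ _ => Set.subset_univ _)).matroid

theorem unionMatroid_indep_iff {α : Type u} [DecidableEq α] {M : Matroid α} {k : ℕ} [NeZero k]
    {I : Finset α} : (unionMatroid M k).Indep (I : Set α) ↔ I ∈ kFoldUnion M k := by
  simp [unionMatroid]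

/-! ### The rank function of a family -/

section familyRank

variable {α : Type u} {𝓕 : Set (Finset α)} {S T : Finset α}

theorem card_le_familyRank (hT : T ∈ 𝓕) (h : T ⊆ S) : T.card ≤ familyRank 𝓕 S := by
  classical
  exact Finset.le_sup (f := Finset.card) (by simp [h, hT])

theorem familyRank_le {n : ℕ} (h : ∀ T ∈ 𝓕, T ⊆ S → T.card ≤ n) : familyRank 𝓕 S ≤ n := by
  classical
  exact Finset.sup_le fun T hT => by
    obtain ⟨h1, h2⟩ := Finset.mem_filter.1 hT
    exact h T h2 (Finset.mem_powerset.1 h1)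

theorem familyRank_mono (h : S ⊆ T) : familyRank 𝓕 S ≤ familyRank 𝓕 T :=
  familyRank_le fun _ hU hUS => card_le_familyRank hU (hUS.trans h)

theorem familyRank_le_card : familyRank 𝓕 S ≤ S.card :=
  familyRank_le fun _ _ h => Finset.card_le_card h

theorem exists_card_eq_familyRank (h𝓕 : ∅ ∈ 𝓕) (S : Finset α) :
    ∃ T ∈ 𝓕, T ⊆ S ∧ T.card = familyRank 𝓕 S := by
  classical
  obtain ⟨T, hT, h⟩ := Finset.exists_mem_eq_sup (S.powerset.filter (· ∈ 𝓕))
    ⟨∅, by simp [h𝓕]⟩ Finset.card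
  obtain ⟨h1, h2⟩ := Finset.mem_filter.1 hT
  exact ⟨T, h2, Finset.mem_powerset.1 h1, h.symm⟩

theorem mem_of_card_le_familyRank (h𝓕 : ∅ ∈ 𝓕) (h : S.card ≤ familyRank 𝓕 S) : S ∈ 𝓕 := by
  obtain ⟨T, hT, hTS, hc⟩ := exists_card_eq_familyRank h𝓕 S
  rwa [← Finset.eq_of_subset_of_card_le hTS (by omega)]

/-- If `𝓕` consists of the finite independent sets of a matroid, then its rank function is that of
the matroid. -/
theorem cast_familyRank {N : Matroid α} (hN : ∀ I : Finset α, N.Indep (I : Set α) ↔ I ∈ 𝓕)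
    (S : Finset α) : (familyRank 𝓕 S : ℕ∞) = N.eRk (S : Set α) := by
  apply le_antisymm
  · obtain ⟨T, hT, hTS, hc⟩ := exists_card_eq_familyRank ((hN ∅).1 (by simp)) S
    rw [← hc, ← Set.encard_coe_eq_coe_finsetCard]
    exact ((hN T).2 hT).encard_le_eRk_of_subset (Finset.coe_subset.2 hTS)
  · refine Matroid.eRk_le_iff.2 fun I hIS hI => ?_
    obtain ⟨I, rfl⟩ := (S.finite_toSet.subset hIS).exists_finset_coe
    rw [Set.encard_coe_eq_coe_finsetCard]
    exact_mod_cast card_le_familyRank ((hN I).1 hI) (Finset.coe_subset.1 hIS)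

end familyRank

section rank

variable {α : Type u} [DecidableEq α] {M : Matroid α} {k : ℕ} [NeZero k]

/-- The rank function of the `k`-fold union is submodular. -/
theorem familyRank_inter_add_union_le (S T : Finset α) :
    familyRank (kFoldUnion M k) (S ∩ T) + familyRank (kFoldUnion M k) (S ∪ T) ≤
      familyRank (kFoldUnion M k) S + familyRank (kFoldUnion M k) T := by
  have h := (unionMatroid M k).eRk_inter_add_eRk_union_le (S : Set α) (T : Set α)
  rw [← Finset.coe_inter, ← Finset.coe_union] at h
  simp only [← cast_familyRank fun I => unionMatroid_indep_iff (M := M) (k := k) (I := I)] at h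
  exact_mod_cast h

/-- Marginal ranks decrease. -/
theorem familyRank_marginal_antitone {S T : Finset α} (h : S ⊆ T) (X : Finset α) :
    familyRank (kFoldUnion M k) (T ∪ X) + familyRank (kFoldUnion M k) S ≤
      familyRank (kFoldUnion M k) (S ∪ X) + familyRank (kFoldUnion M k) T := by
  have h1 := familyRank_inter_add_union_le (M := M) (k := k) (S ∪ X) T
  have h2 : S ∪ X ∪ T = T ∪ X := by
    ext a; simp only [Finset.mem_union]; have := @h a; tauto
  have h3 : familyRank (kFoldUnion M k) S ≤ familyRank (kFoldUnion M k) ((S ∪ X) ∩ T) :=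
    familyRank_mono (Finset.subset_inter Finset.subset_union_left h)
  rw [h2] at h1
  omega

theorem familyRank_union_le (S T : Finset α) :
    familyRank (kFoldUnion M k) (S ∪ T) ≤
      familyRank (kFoldUnion M k) S + familyRank (kFoldUnion M k) T := by
  have := familyRank_inter_add_union_le (M := M) (k := k) S T
  omega

theorem familyRank_insert_le (S : Finset α) (a : α) :
    familyRank (kFoldUnion M k) (insert a S) ≤ familyRank (kFoldUnion M k) S + 1 := by
  have h := familyRank_union_le (M := M) (k := k) S {a}
  have h2 : familyRank (kFoldUnion M k) {a} ≤ 1 := familyRank_le_card.trans (by simp)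
  rw [Finset.union_comm, ← Finset.insert_eq] at h
  omega

end rank

/-! ### The extended union and the occupancy function -/

section extendedUnion

variable {E : Type u} {k : ℕ}

theorem mem_copies {B : Finset E} {a : E × Fin k} : a ∈ copies k B ↔ a.1 ∈ B := by
  simp [copies]

theorem copies_mono {S T : Finset E} (h : S ⊆ T) : copies k S ⊆ copies k T :=
  Finset.product_subset_product_left h

variable [DecidableEq E] {M : Matroid E}

theorem copies_union (S T : Finset E) : copies k (S ∪ T) = copies k S ∪ copies k T :=
  Finset.union_product

/-- The rank of `B` in `M`, as a natural number. -/
noncomputable def baseRank (M : Matroid E) (B : Finset E) : ℕ :=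
  familyRank {I : Finset E | M.Indep (I : Set E)} B

theorem baseRank_insert_le (M : Matroid E) (e : E) (B : Finset E) :
    baseRank M (insert e B) ≤ baseRank M B + 1 := by
  have h := M.eRk_insert_le_add_one e (B : Set E)
  rw [← Finset.coe_insert] at h
  have hM : ∀ I : Finset E, M.Indep (I : Set E) ↔ I ∈ {I : Finset E | M.Indep (I : Set E)} :=
    fun I => Iff.rfl
  rw [← cast_familyRank hM, ← cast_familyRank hM] at h
  exact_mod_cast h

theorem card_le_mul_baseRank {F B : Finset E} (hF : F ∈ kFoldUnion M k) (hFB : F ⊆ B) :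
    F.card ≤ k * baseRank M B := by
  obtain ⟨I, hI, rfl⟩ := hF
  refine (Finset.card_biUnion_le_card_mul _ _ (baseRank M B) fun i hi => ?_).trans (by simp)
  exact card_le_familyRank (hI i) ((Finset.subset_biUnion_of_mem I hi).trans hFB)

/-- Forgetting the copy index maps a feasible set of the extended union to one of the union. -/
theorem image_fst_mem_kFoldUnion {S : Finset (E × Fin k)} (hS : S ∈ extendedUnion M k) :
    S.image Prod.fst ∈ kFoldUnion M k := by
  obtain ⟨I, hI, rfl⟩ := hS
  refine ⟨fun i => (I i).image Prod.fst, fun i => ?_, Finset.biUnion_image⟩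
  rw [Finset.coe_image]
  exact (Matroid.comap_indep_iff.1 (hI i)).1

theorem familyRank_copies (B : Finset E) :
    familyRank (extendedUnion M k) (copies k B) = k * baseRank M B := by
  apply le_antisymm
  · refine familyRank_le fun T hT hTB => ?_
    obtain ⟨I, hI, rfl⟩ := hT
    refine (Finset.card_biUnion_le_card_mul _ _ (baseRank M B) fun i hi => ?_).trans (by simp)
    obtain ⟨h1, h2⟩ := Matroid.comap_indep_iff.1 (hI i)
    rw [← Finset.card_image_of_injOn h2]
    refine card_le_familyRank (𝓕 := {I : Finset E | M.Indep (I : Set E)}) ?_ ?_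
    · simpa using h1
    · intro e he
      obtain ⟨a, ha, rfl⟩ := Finset.mem_image.1 he
      exact mem_copies.1 (hTB (Finset.mem_biUnion.2 ⟨i, hi, ha⟩))
  · obtain ⟨I, hI, hIB, hc⟩ := exists_card_eq_familyRank
      (𝓕 := {I : Finset E | M.Indep (I : Set E)}) (by simp) B
    have hmem : copies k I ∈ extendedUnion M k := by
      refine ⟨fun i => I ×ˢ {i}, fun i => Matroid.comap_indep_iff.2 ⟨?_, ?_⟩, ?_⟩
      · refine Matroid.Indep.subset (show M.Indep (I : Set E) from hI) ?_
        rintro _ ⟨a, ha, rfl⟩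
        exact (Finset.mem_product.1 (Finset.mem_coe.1 ha)).1
      · rintro ⟨a, i'⟩ ha ⟨b, j'⟩ hb hab
        simp only [Finset.coe_product, Finset.coe_singleton, Set.mem_prod,
          Set.mem_singleton_iff] at ha hb
        exact Prod.ext hab (ha.2.trans hb.2.symm)
      · ext ⟨e, i⟩
        simp [copies]
    have := card_le_familyRank hmem (copies_mono hIB)
    rw [copies, Finset.card_product, hc, Finset.card_univ, Fintype.card_fin, mul_comm] at this
    exact this

/-- The feasible sets of the extended union are invariant under permuting the copies of each
element. -/
theorem image_mem_extendedUnion {σ : Equiv.Perm (E × Fin k)} (hσ : ∀ a, (σ a).1 = a.1)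
    {S : Finset (E × Fin k)} (hS : S ∈ extendedUnion M k) : S.image σ ∈ extendedUnion M k := by
  obtain ⟨I, hI, rfl⟩ := hS
  refine ⟨fun i => (I i).image σ, fun i => ?_, Finset.biUnion_image⟩
  obtain ⟨h1, h2⟩ := Matroid.comap_indep_iff.1 (hI i)
  refine Matroid.comap_indep_iff.2 ⟨?_, ?_⟩
  · rw [Finset.coe_image, Set.image_image]
    simpa only [hσ] using h1
  · rw [Finset.coe_image]
    rintro _ ⟨a, ha, rfl⟩ _ ⟨b, hb, rfl⟩ hab
    rw [hσ, hσ] at hab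
    rw [h2 ha hb hab]

theorem insert_mem_extendedUnion_of_insert {e : E} {i j : Fin k} {S : Finset (E × Fin k)}
    (hi : (e, i) ∉ S) (hj : (e, j) ∉ S) (h : insert (e, i) S ∈ extendedUnion M k) :
    insert (e, j) S ∈ extendedUnion M k := by
  have h1 := image_mem_extendedUnion (σ := Equiv.swap (e, i) (e, j)) (fun a => by
    rw [Equiv.swap_apply_def]; split_ifs with h1 h2 <;> simp [*]) h
  have h2 : S.image (Equiv.swap (e, i) (e, j)) = S := by
    conv_rhs => rw [← Finset.image_id (s := S)]
    refine Finset.image_congr fun a ha => ?_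
    refine Equiv.swap_apply_of_ne_of_ne ?_ ?_ <;> rintro rfl
    exacts [hi ha, hj ha]
  rwa [Finset.image_insert, Equiv.swap_apply_left, h2] at h1

theorem occ_le (e : E) (S : Finset (E × Fin k)) : occ M k e S ≤ k := by
  have : familyRank (extendedUnion M k) S ≤ familyRank (extendedUnion M k) (S ∪ copies k {e}) :=
    familyRank_mono Finset.subset_union_left
  have : (familyRank (extendedUnion M k) S : ℝ) ≤
    familyRank (extendedUnion M k) (S ∪ copies k {e}) := by exact_mod_cast this
  unfold occ
  linarith

variable [NeZero k]

theorem occ_mono (e : E) {S T : Finset (E × Fin k)} (h : S ⊆ T) : occ M k e S ≤ occ M k e T := by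
  have : familyRank (extendedUnion M k) (T ∪ copies k {e}) + familyRank (extendedUnion M k) S ≤
      familyRank (extendedUnion M k) (S ∪ copies k {e}) + familyRank (extendedUnion M k) T :=
    familyRank_marginal_antitone h _
  have : (familyRank (extendedUnion M k) (T ∪ copies k {e}) : ℝ) +
      familyRank (extendedUnion M k) S ≤
      familyRank (extendedUnion M k) (S ∪ copies k {e}) + familyRank (extendedUnion M k) T := by
    exact_mod_cast this
  unfold occ
  linarith

theorem occ_insert_le (e : E) (a : E × Fin k) (S : Finset (E × Fin k)) :
    occ M k e (insert a S) ≤ occ M k e S + 1 := by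
  have h1 : familyRank (extendedUnion M k) (insert a S) ≤ familyRank (extendedUnion M k) S + 1 :=
    familyRank_insert_le _ _
  have h2 : familyRank (extendedUnion M k) (S ∪ copies k {e}) ≤
      familyRank (extendedUnion M k) (insert a S ∪ copies k {e}) :=
    familyRank_mono (Finset.union_subset_union_left (Finset.subset_insert _ _))
  have h1 : (familyRank (extendedUnion M k) (insert a S) : ℝ) ≤
    familyRank (extendedUnion M k) S + 1 := by exact_mod_cast h1
  have h2 : (familyRank (extendedUnion M k) (S ∪ copies k {e}) : ℝ) ≤
    familyRank (extendedUnion M k) (insert a S ∪ copies k {e}) := by exact_mod_cast h2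
  unfold occ
  linarith

/-- If a set without copies of `e` spans one copy of `e`, then by symmetry it spans all of them, so
`e` is fully occupied. -/
theorem occ_eq_of_inSpan {e : E} {S : Finset (E × Fin k)} (hS : ∀ i, (e, i) ∉ S)
    (h : InSpan (extendedUnion M k) S (e, 0)) : occ M k e S = k := by
  obtain ⟨I, hI, hIS, hc⟩ := exists_card_eq_familyRank
    (𝓕 := extendedUnion M k) (empty_mem_kFoldUnion _ _) S
  have hnot : ∀ i, insert (e, i) I ∉ extendedUnion M k := by
    intro i hi
    have h0 := insert_mem_extendedUnion_of_insert (j := 0) (fun h => hS _ (hIS h))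
      (fun h => hS _ (hIS h)) hi
    have h1 := card_le_familyRank h0 (Finset.insert_subset_insert (e, (0 : Fin k)) hIS)
    rw [Finset.card_insert_of_notMem (fun h => hS _ (hIS h)), ← h] at h1
    omega
  have hle : familyRank (extendedUnion M k) (S ∪ copies k {e}) ≤
      familyRank (extendedUnion M k) S := by
    refine familyRank_le fun T hT hTS => ?_
    by_contra! hlt
    rw [← hc] at hlt
    obtain ⟨a, haT, haI, ha⟩ := kFoldUnion_augment hI hT hlt
    rcases Finset.mem_union.1 (hTS haT) with haS | hae
    · have h1 := card_le_familyRank (show insert a I ∈ extendedUnion M k from ha)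
        (Finset.insert_subset haS hIS)
      rw [Finset.card_insert_of_notMem haI] at h1
      omega
    · have : a = (e, a.2) := Prod.ext (by simpa using mem_copies.1 hae) rfl
      rw [this] at ha
      exact hnot _ ha
  have hle : (familyRank (extendedUnion M k) (S ∪ copies k {e}) : ℝ) ≤
    familyRank (extendedUnion M k) S := by exact_mod_cast hle
  refine le_antisymm (occ_le _ _) ?_
  unfold occ
  linarith

/-- If `e` is spanned by `B` in `M`, then the copies of `B` already span all copies of `e`. -/
theorem familyRank_union_copies_insert {e : E} {B : Finset E}
    (h : baseRank M (insert e B) = baseRank M B) (R : Finset (E × Fin k)) :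
    familyRank (extendedUnion M k) (R ∪ copies k (insert e B)) =
      familyRank (extendedUnion M k) (R ∪ copies k B) := by
  have hins : copies k (insert e B) = copies k B ∪ copies k {e} := by
    rw [← copies_union, Finset.union_comm, Finset.insert_eq]
  have h1 : familyRank (extendedUnion M k) (R ∪ copies k B ∪ copies k {e}) +
      familyRank (extendedUnion M k) (copies k B) ≤
      familyRank (extendedUnion M k) (copies k B ∪ copies k {e}) +
      familyRank (extendedUnion M k) (R ∪ copies k B) :=
    familyRank_marginal_antitone Finset.subset_union_right _
  rw [← hins, familyRank_copies, familyRank_copies, h, Finset.union_assoc, ← hins] at h1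
  refine le_antisymm (by omega) (familyRank_mono ?_)
  exact Finset.union_subset_union_right (copies_mono (Finset.subset_insert _ _))

end extendedUnion

/-! ### The polytope of the union -/

section polytope

variable {E : Type u} {x : E → ℝ}

theorem polytope_subset {𝓕 : Set (Finset E)} {K : Set (E → ℝ)} (hK : Convex ℝ K)
    (h : ∀ S ∈ 𝓕, Set.indicator (S : Set E) (1 : E → ℝ) ∈ K) (hx : x ∈ polytope 𝓕) : x ∈ K :=
  convexHull_min (Set.image_subset_iff.2 h) hK hx

theorem nonneg_of_mem_polytope {𝓕 : Set (Finset E)} (hx : x ∈ polytope 𝓕) (e : E) : 0 ≤ x e := by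
  refine polytope_subset (K := {x | 0 ≤ x e})
    (convex_halfSpace_ge (LinearMap.proj (R := ℝ) (φ := fun _ : E => ℝ) e).isLinear 0) ?_ hx
  exact fun S _ => Set.indicator_nonneg (f := (1 : E → ℝ)) (fun _ _ => zero_le_one) e

theorem le_one_of_mem_polytope {𝓕 : Set (Finset E)} (hx : x ∈ polytope 𝓕) (e : E) : x e ≤ 1 := by
  refine polytope_subset (K := {x | x e ≤ 1})
    (convex_halfSpace_le (LinearMap.proj (R := ℝ) (φ := fun _ : E => ℝ) e).isLinear 1) ?_ hx
  exact fun S _ => Set.indicator_le_self' (f := (1 : E → ℝ)) (fun _ _ => zero_le_one) e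

theorem sum_le_of_mem_polytope [DecidableEq E] {M : Matroid E} {k : ℕ}
    (hx : x ∈ polytope (kFoldUnion M k)) (B : Finset E) :
    ∑ e ∈ B, x e ≤ k * baseRank M B := by
  refine polytope_subset (K := {x | ∑ e ∈ B, x e ≤ k * baseRank M B})
    (convex_halfSpace_le ⟨fun x y => ?_, fun c x => ?_⟩ _) (fun S hS => ?_) hx
  · simp [Finset.sum_add_distrib]
  · simp [Finset.mul_sum]
  · have h := card_le_mul_baseRank (kFoldUnion_subset hS Finset.inter_subset_right)
      (Finset.inter_subset_left (s₁ := B) (s₂ := S))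
    have : ∑ e ∈ B, Set.indicator (S : Set E) (1 : E → ℝ) e = (B ∩ S).card := by
      simp [Set.indicator_apply]
    change ∑ e ∈ B, Set.indicator (S : Set E) (1 : E → ℝ) e ≤ _
    rw [this]
    exact_mod_cast h

end polytope

/-! ### Expectations over independent random subsets -/

section subsetExp

variable {α : Type u} [DecidableEq α]

/-- The expectation of `g R` for the random subset `R` of `N` that contains each `a ∈ N`
independently with probability `p a`. -/
noncomputable def subsetExp (N : Finset α) (p : α → ℝ) (g : Finset α → ℝ) : ℝ :=
  ∑ R ∈ N.powerset, subsetProb N p R * g R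

variable {N : Finset α} {p q : α → ℝ} {g h : Finset α → ℝ}

theorem subsetExp_empty (p : α → ℝ) (g : Finset α → ℝ) : subsetExp ∅ p g = g ∅ := by
  simp [subsetExp, subsetProb]

theorem subsetExp_congr (H : ∀ R ⊆ N, g R = h R) : subsetExp N p g = subsetExp N p h :=
  Finset.sum_congr rfl fun R hR => by rw [H R (Finset.mem_powerset.1 hR)]

theorem subsetExp_mono (h0 : ∀ a, 0 ≤ p a) (h1 : ∀ a, p a ≤ 1) (H : ∀ R ⊆ N, g R ≤ h R) :
    subsetExp N p g ≤ subsetExp N p h :=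
  Finset.sum_le_sum fun R hR => mul_le_mul_of_nonneg_left (H R (Finset.mem_powerset.1 hR))
    (subsetProb_nonneg N p h0 h1 R)

theorem subsetExp_const (c : ℝ) : subsetExp N p (fun _ => c) = c := by
  rw [subsetExp, ← Finset.sum_mul, sum_subsetProb, one_mul]

theorem subsetExp_nonneg (h0 : ∀ a, 0 ≤ p a) (h1 : ∀ a, p a ≤ 1) (H : ∀ R, 0 ≤ g R) :
    0 ≤ subsetExp N p g :=
  Finset.sum_nonneg fun R _ => mul_nonneg (subsetProb_nonneg N p h0 h1 R) (H R)

theorem subsetExp_add :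
    subsetExp N p (fun R => g R + h R) = subsetExp N p g + subsetExp N p h := by
  simp only [subsetExp, mul_add, Finset.sum_add_distrib]

theorem subsetExp_sub :
    subsetExp N p (fun R => g R - h R) = subsetExp N p g - subsetExp N p h := by
  simp only [subsetExp, mul_sub, Finset.sum_sub_distrib]

theorem subsetExp_const_mul (c : ℝ) :
    subsetExp N p (fun R => c * g R) = c * subsetExp N p g := by
  rw [subsetExp, subsetExp, Finset.mul_sum]
  exact Finset.sum_congr rfl fun R _ => by ring

/-- Conditioning on whether `a` belongs to the random set. -/
theorem subsetExp_insert {a : α} (ha : a ∉ N) :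
    subsetExp (insert a N) p g =
      (1 - p a) * subsetExp N p g + p a * subsetExp N p fun R => g (insert a R) := by
  simp only [subsetExp]
  rw [Finset.sum_powerset_insert ha, Finset.mul_sum, Finset.mul_sum]
  congr 1 <;> refine Finset.sum_congr rfl fun R hR => ?_
  · have haR : a ∉ R := fun h => ha (Finset.mem_powerset.1 hR h)
    rw [subsetProb, subsetProb, Finset.insert_sdiff_of_notMem _ haR,
      Finset.prod_insert (fun h => ha (Finset.mem_sdiff.1 h).1)]
    ring
  · have haR : a ∉ R := fun h => ha (Finset.mem_powerset.1 hR h)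
    have : insert a N \ insert a R = N \ R := by
      rw [Finset.insert_sdiff_insert, Finset.sdiff_insert_of_notMem ha]
    rw [subsetProb, subsetProb, this, Finset.prod_insert haR]
    ring

theorem subsetExp_card : subsetExp N p (fun R => (R.card : ℝ)) = ∑ a ∈ N, p a := by
  induction N using Finset.induction_on with
  | empty => simp [subsetExp_empty]
  | insert a N ha ih =>
    have : subsetExp N p (fun R => ((insert a R).card : ℝ)) =
        subsetExp N p (fun R => (R.card : ℝ) + 1) :=
      subsetExp_congr fun R hR => by
        rw [Finset.card_insert_of_notMem fun h => ha (hR h)]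
        push_cast
        rfl
    rw [subsetExp_insert ha, this, subsetExp_add, subsetExp_const, ih, Finset.sum_insert ha]
    ring

/-- The intersection of two independent random subsets. -/
theorem subsetExp_inter :
    subsetExp N p (fun R => subsetExp N q fun K => g (R ∩ K)) =
      subsetExp N (fun a => p a * q a) g := by
  induction N using Finset.induction_on generalizing g with
  | empty => simp [subsetExp_empty]
  | insert a N ha ih =>
    have h1 : subsetExp N p (fun R => subsetExp (insert a N) q fun K => g (R ∩ K)) =
        subsetExp N (fun a => p a * q a) g := by
      rw [← ih]
      refine subsetExp_congr fun R hR => ?_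
      have : subsetExp N q (fun K => g (R ∩ insert a K)) = subsetExp N q fun K => g (R ∩ K) := by
        simp only [Finset.inter_insert_of_notMem fun h => ha (hR h)]
      rw [subsetExp_insert ha, this]
      ring
    have h2 : subsetExp N p (fun R => subsetExp (insert a N) q fun K => g (insert a R ∩ K)) =
        (1 - q a) * subsetExp N (fun a => p a * q a) g +
          q a * subsetExp N (fun a => p a * q a) fun R => g (insert a R) := by
      rw [← ih, ← ih, ← subsetExp_const_mul, ← subsetExp_const_mul, ← subsetExp_add]
      refine subsetExp_congr fun R hR => ?_
      rw [subsetExp_insert ha]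
      congr 2
      · exact subsetExp_congr fun K hK => by rw [Finset.insert_inter_of_notMem fun h => ha (hK h)]
      · exact subsetExp_congr fun K hK => by rw [← Finset.insert_inter_distrib]
    rw [subsetExp_insert ha, h1, h2, subsetExp_insert ha]
    ring

theorem subsetExp_union_of_inter {B D : Finset α} (hBD : Disjoint B D) :
    subsetExp (B ∪ D) p (fun R => g (R ∩ B)) = subsetExp B p g := by
  induction D using Finset.induction_on with
  | empty =>
    rw [Finset.union_empty]
    exact subsetExp_congr fun R hR => by rw [Finset.inter_eq_left.2 hR]
  | insert a D ha ih =>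
    rw [Finset.disjoint_insert_right] at hBD
    have haBD : a ∉ B ∪ D := by simp [hBD.1, ha]
    rw [Finset.union_insert, subsetExp_insert haBD]
    simp only [Finset.insert_inter_of_notMem hBD.1]
    rw [ih hBD.2]
    ring

theorem subsetExp_of_subset {B : Finset α} (hB : B ⊆ N) :
    subsetExp N p (fun R => g (R ∩ B)) = subsetExp B p g := by
  conv_lhs => rw [← Finset.union_sdiff_of_subset hB]
  exact subsetExp_union_of_inter Finset.disjoint_sdiff

theorem subsetExp_union_of_eq_zero {B D : Finset α} (hBD : Disjoint B D) (hp : ∀ a ∈ D, p a = 0) :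
    subsetExp (B ∪ D) p g = subsetExp B p g := by
  induction D using Finset.induction_on with
  | empty => rw [Finset.union_empty]
  | insert a D ha ih =>
    rw [Finset.disjoint_insert_right] at hBD
    have haBD : a ∉ B ∪ D := by simp [hBD.1, ha]
    rw [Finset.union_insert, subsetExp_insert haBD, hp a (Finset.mem_insert_self _ _),
      ih hBD.2 fun b hb => hp b (Finset.mem_insert_of_mem hb)]
    ring

theorem subsetExp_map {β : Type u} [DecidableEq β] (ι : β ↪ α) (B : Finset β) :
    subsetExp (B.map ι) p g = subsetExp B (fun b => p (ι b)) fun Q => g (Q.map ι) := by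
  induction B using Finset.induction_on generalizing g with
  | empty => simp [subsetExp_empty]
  | insert b B hb ih =>
    rw [Finset.map_insert, subsetExp_insert (by simpa using hb), subsetExp_insert hb, ih, ih]
    simp only [Finset.map_insert]

/-- The event `a ∈ R` is independent of `R \ {a}`. -/
theorem subsetExp_mem_erase {a : α} (ha : a ∈ N) :
    subsetExp N p (fun R => if a ∈ R then g (R.erase a) else 0) =
      p a * subsetExp N p fun R => g (R.erase a) := by
  have ha' : a ∉ N.erase a := Finset.notMem_erase a N
  have h1 : subsetExp (N.erase a) p (fun R => if a ∈ R then g (R.erase a) else 0) = 0 := by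
    refine (subsetExp_congr fun R hR => ?_).trans (subsetExp_const 0)
    exact if_neg fun h => ha' (hR h)
  have h2 : subsetExp (N.erase a) p (fun R => g (R.erase a)) = subsetExp (N.erase a) p g :=
    subsetExp_congr fun R hR => by rw [Finset.erase_eq_of_notMem fun h => ha' (hR h)]
  have h3 : subsetExp (N.erase a) p (fun R => g ((insert a R).erase a)) =
      subsetExp (N.erase a) p g :=
    subsetExp_congr fun R hR => by rw [Finset.erase_insert fun h => ha' (hR h)]
  rw [← Finset.insert_erase ha, subsetExp_insert ha', subsetExp_insert ha', h1, h2, h3]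
  simp only [Finset.mem_insert_self, if_true]
  rw [h3]
  ring

/-- The inductive step of the moment generating function bound: conditioning on one coordinate. -/
theorem one_add_mul_exp_sub_one_le {l p d : ℝ} (hl : 0 ≤ l) (hp : 0 ≤ p) (hd0 : 0 ≤ d)
    (hd1 : d ≤ 1) :
    1 + Real.exp (-l) * p * (Real.exp (l * d) - 1) ≤ Real.exp (l * (p * d)) := by
  have h1 : Real.exp (-l) * (Real.exp (l * d) - 1) ≤ l * d := by
    have h2 : Real.exp (l * d) - 1 ≤ l * d * Real.exp (l * d) := by
      have h3 := Real.add_one_le_exp (-(l * d))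
      have h4 := mul_le_mul_of_nonneg_right h3 (Real.exp_pos (l * d)).le
      rw [← Real.exp_add, neg_add_cancel, Real.exp_zero] at h4
      linarith
    have h5 : Real.exp (-l) * Real.exp (l * d) ≤ 1 := by
      rw [← Real.exp_add, Real.exp_le_one_iff]
      nlinarith
    calc Real.exp (-l) * (Real.exp (l * d) - 1)
        ≤ Real.exp (-l) * (l * d * Real.exp (l * d)) := by gcongr
      _ = l * d * (Real.exp (-l) * Real.exp (l * d)) := by ring
      _ ≤ l * d * 1 := by gcongr
      _ = l * d := mul_one _
  have h6 := Real.add_one_le_exp (l * (p * d))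
  nlinarith [mul_le_mul_of_nonneg_left h1 hp]

/-- **Concentration by thinning.** Let `f` be monotone with marginals at most `1`. If the inclusion
probabilities are thinned by the factor `exp (-l)`, then the moment generating function of `f` at
`l` is at most the exponential of `l` times the expectation of `f` without thinning. In contrast to
bounded difference inequalities, the bound does not depend on the number of coordinates. -/
theorem subsetExp_exp_le {l : ℝ} (hl : 0 ≤ l) (h0 : ∀ a, 0 ≤ p a) (h1 : ∀ a, p a ≤ 1)
    {f : Finset α → ℝ} (hf0 : ∀ a S, f S ≤ f (insert a S)) (hf1 : ∀ a S, f (insert a S) ≤ f S + 1) :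
    subsetExp N (fun a => Real.exp (-l) * p a) (fun R => Real.exp (l * f R)) ≤
      Real.exp (l * subsetExp N p f) := by
  induction N using Finset.induction_on generalizing f with
  | empty => simp [subsetExp_empty]
  | insert a N ha ih =>
    have ih0 := ih hf0 hf1
    have ih1 := ih (f := fun R => f (insert a R))
      (fun b S => by rw [Finset.insert_comm]; exact hf0 _ _)
      (fun b S => by rw [Finset.insert_comm]; exact hf1 _ _)
    rw [subsetExp_insert ha, subsetExp_insert ha]
    set F₀ := subsetExp N p f
    set F₁ := subsetExp N p fun R => f (insert a R) with hF₁
    have hd0 : 0 ≤ F₁ - F₀ := sub_nonneg.2 (subsetExp_mono h0 h1 fun R _ => hf0 a R)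
    have hd1 : F₁ - F₀ ≤ 1 := by
      have : F₁ ≤ subsetExp N p (fun R => f R + 1) := subsetExp_mono h0 h1 fun R _ => hf1 a R
      rw [subsetExp_add, subsetExp_const] at this
      linarith
    have hq0 : 0 ≤ Real.exp (-l) * p a := mul_nonneg (Real.exp_pos _).le (h0 a)
    have hq1 : Real.exp (-l) * p a ≤ 1 :=
      mul_le_one₀ (Real.exp_le_one_iff.2 (neg_nonpos.2 hl)) (h0 a) (h1 a)
    have key := one_add_mul_exp_sub_one_le hl (h0 a) hd0 hd1
    calc _ ≤ (1 - Real.exp (-l) * p a) * Real.exp (l * F₀) +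
            Real.exp (-l) * p a * Real.exp (l * F₁) :=
          add_le_add (mul_le_mul_of_nonneg_left ih0 (sub_nonneg.2 hq1))
            (mul_le_mul_of_nonneg_left ih1 hq0)
      _ = Real.exp (l * F₀) *
            (1 + Real.exp (-l) * p a * (Real.exp (l * (F₁ - F₀)) - 1)) := by
          have : Real.exp (l * F₁) = Real.exp (l * F₀) * Real.exp (l * (F₁ - F₀)) := by
            rw [← Real.exp_add]; ring_nf
          rw [this]
          ring
      _ ≤ Real.exp (l * F₀) * Real.exp (l * (p a * (F₁ - F₀))) :=
          mul_le_mul_of_nonneg_left key (Real.exp_pos _).le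
      _ = Real.exp (l * ((1 - p a) * F₀ + p a * F₁)) := by
          rw [← Real.exp_add]; ring_nf

/-- The tail bound obtained from `subsetExp_exp_le` by Markov's inequality. -/
theorem subsetExp_tail_le {l c : ℝ} (hl : 0 ≤ l) (h0 : ∀ a, 0 ≤ p a) (h1 : ∀ a, p a ≤ 1)
    {f : Finset α → ℝ} (hf0 : ∀ a S, f S ≤ f (insert a S)) (hf1 : ∀ a S, f (insert a S) ≤ f S + 1) :
    subsetExp N (fun a => Real.exp (-l) * p a) (fun R => if c ≤ f R then 1 else 0) ≤
      Real.exp (l * (subsetExp N p f - c)) := by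
  have hq1 : ∀ a, Real.exp (-l) * p a ≤ 1 := fun a =>
    mul_le_one₀ (Real.exp_le_one_iff.2 (neg_nonpos.2 hl)) (h0 a) (h1 a)
  calc _ ≤ subsetExp N (fun a => Real.exp (-l) * p a)
          (fun R => Real.exp (-(l * c)) * Real.exp (l * f R)) := by
        refine subsetExp_mono (fun a => mul_nonneg (Real.exp_pos _).le (h0 a)) hq1 fun R _ => ?_
        rw [← Real.exp_add]
        split_ifs with h
        · refine Real.one_le_exp ?_
          nlinarith
        · exact (Real.exp_pos _).le
    _ ≤ Real.exp (-(l * c)) * Real.exp (l * subsetExp N p f) := by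
        rw [subsetExp_const_mul]
        exact mul_le_mul_of_nonneg_left (subsetExp_exp_le hl h0 h1 hf0 hf1) (Real.exp_pos _).le
    _ = Real.exp (l * (subsetExp N p f - c)) := by
        rw [← Real.exp_add]; ring_nf

end subsetExp

/-! ### Protection sets and the chain -/

section protect

variable {E : Type u} [DecidableEq E] {M : Matroid E} {k : ℕ} {b : ℝ} {y : E × Fin k → ℝ}
  {B : Finset E}

theorem protectStep_subset {S : Finset E} (hS : S ⊆ B) : protectStep M k b y B S ⊆ B := by
  unfold protectStep
  split_ifs with h
  · exact Finset.insert_subset (Finset.mem_sdiff.1 h.choose_spec.1).1 hS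
  · exact hS

theorem protectStep_iterate_subset (n : ℕ) : (protectStep M k b y B)^[n] ∅ ⊆ B := by
  induction n with
  | zero => simp
  | succ n ih =>
    rw [Function.iterate_succ_apply']
    exact protectStep_subset ih

theorem protect_subset : protect M k b y B ⊆ B :=
  protectStep_iterate_subset _

/-- Until the iteration becomes stationary, each step adds one element. -/
theorem protectStep_iterate_eq_or_card (n : ℕ) :
    protectStep M k b y B ((protectStep M k b y B)^[n] ∅) = (protectStep M k b y B)^[n] ∅ ∨
      ((protectStep M k b y B)^[n] ∅).card = n := by
  induction n with
  | zero => simp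
  | succ n ih =>
    rw [Function.iterate_succ_apply']
    rcases ih with ih | ih
    · rw [ih]
      exact Or.inl ih
    · generalize (protectStep M k b y B)^[n] ∅ = S at ih
      by_cases h : ∃ e, e ∈ B \ S ∧ b * k < expectedOcc M k y B S e
      · right
        rw [protectStep, dif_pos h,
          Finset.card_insert_of_notMem (Finset.mem_sdiff.1 h.choose_spec.1).2, ih]
      · left
        have : protectStep M k b y B S = S := dif_neg h
        rw [this, this]

/-- The unprotected elements have small expected occupancy. -/
theorem expectedOcc_protect_le {e : E} (he : e ∈ B \ protect M k b y B) :
    expectedOcc M k y B (protect M k b y B) e ≤ b * k := by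
  by_contra! hlt
  have hex : ∃ e, e ∈ B \ protect M k b y B ∧
    b * k < expectedOcc M k y B (protect M k b y B) e := ⟨e, he, hlt⟩
  rcases protectStep_iterate_eq_or_card (M := M) (k := k) (b := b) (y := y) (B := B) B.card
    with h | h
  · change protectStep M k b y B (protect M k b y B) = protect M k b y B at h
    rw [protectStep, dif_pos hex] at h
    exact (Finset.mem_sdiff.1 hex.choose_spec.1).2 (Finset.insert_eq_self.1 h)
  · have := Finset.eq_of_subset_of_card_le (protect_subset (M := M) (b := b) (y := y) (B := B)) h.ge
    rw [this] at he
    simp at he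

theorem expectedOcc_eq (S : Finset E) (e : E) :
    expectedOcc M k y B S e = k -
      subsetExp (copies k B) y
        (fun R => (familyRank (extendedUnion M k) (R ∪ copies k (insert e S)) : ℝ)) +
      subsetExp (copies k B) y
        (fun R => (familyRank (extendedUnion M k) (R ∪ copies k S) : ℝ)) := by
  conv_rhs => rw [← subsetExp_const (N := copies k B) (p := y) (k : ℝ)]
  rw [← subsetExp_sub, ← subsetExp_add]
  refine subsetExp_congr fun R _ => ?_
  rw [occ, Finset.union_assoc, ← copies_union, Finset.union_comm S, ← Finset.insert_eq]

theorem chain_succ_subset [Fintype E] (j : ℕ) :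
    chain M k b y (j + 1) ⊆ chain M k b y j :=
  protect_subset

theorem chain_antitone [Fintype E] : Antitone (chain M k b y) :=
  antitone_nat_of_succ_le chain_succ_subset

variable [NeZero k]

/-- Adding an element with large expected occupancy to the protected set `S` increases the expected
rank of `R ∪ (S × [k])` by less than `(1 - b) k` if it increases the rank of `S` in `M`, and not at
all otherwise. -/
theorem subsetExp_familyRank_protectStep_iterate (hy0 : ∀ a, 0 ≤ y a) (hy1 : ∀ a, y a ≤ 1) (n : ℕ) :
    let S := (protectStep M k b y B)^[n] ∅
    let φ := subsetExp (copies k B) y fun R =>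
      (familyRank (extendedUnion M k) (R ∪ copies k S) : ℝ)
    φ ≤ ∑ a ∈ copies k B, y a + (1 - b) * k * baseRank M S ∧
      (baseRank M S ≠ 0 → φ < ∑ a ∈ copies k B, y a + (1 - b) * k * baseRank M S) := by
  induction n with
  | zero =>
    have h0 : baseRank M ∅ = 0 := Nat.le_zero.1 (familyRank_le_card.trans (by simp))
    simp only [Function.iterate_zero, id_eq, h0]
    refine ⟨?_, fun h => absurd rfl h⟩
    rw [← subsetExp_card, Nat.cast_zero, mul_zero, add_zero]
    refine subsetExp_mono hy0 hy1 fun R _ => ?_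
    have : copies k (∅ : Finset E) = ∅ := by simp [copies]
    rw [this, Finset.union_empty]
    exact_mod_cast familyRank_le_card
  | succ n ih =>
    rw [Function.iterate_succ_apply']
    generalize (protectStep M k b y B)^[n] ∅ = S at ih
    by_cases h : ∃ e, e ∈ B \ S ∧ b * k < expectedOcc M k y B S e
    · have hlt := h.choose_spec.2
      rw [protectStep, dif_pos h]
      generalize h.choose = e at hlt
      rw [expectedOcc_eq] at hlt
      rcases (familyRank_mono (Finset.subset_insert e S)).eq_or_lt with heq | hne
      · change baseRank M S = baseRank M (insert e S) at heq
        simpa only [familyRank_union_copies_insert heq.symm, ← heq] using ih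
      · change baseRank M S < baseRank M (insert e S) at hne
        have hr : baseRank M (insert e S) = baseRank M S + 1 := by
          have := baseRank_insert_le M e S
          omega
        have h1 := ih.1
        simp only [hr]
        push_cast
        exact ⟨by linarith, fun _ => by linarith⟩
    · have : protectStep M k b y B S = S := dif_neg h
      rw [this]
      exact ih

end protect

section chain

variable {E : Type u} {k : ℕ} [NeZero k] {x : E → ℝ}

theorem liftedVector_nonneg (hx : ∀ e, 0 ≤ x e) (a : E × Fin k) : 0 ≤ liftedVector k x a := by
  unfold liftedVector
  split_ifs
  exacts [mul_nonneg (scaleParam_nonneg k) (hx _), le_rfl]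

theorem liftedVector_le_one (hx0 : ∀ e, 0 ≤ x e) (hx1 : ∀ e, x e ≤ 1) (a : E × Fin k) :
    liftedVector k x a ≤ 1 := by
  unfold liftedVector
  split_ifs
  exacts [mul_le_one₀ (scaleParam_le_one k) (hx0 _) (hx1 _), zero_le_one]

theorem sum_liftedVector_copies (B : Finset E) :
    ∑ a ∈ copies k B, liftedVector k x a = scaleParam k * ∑ e ∈ B, x e := by
  rw [copies, Finset.sum_product, Finset.mul_sum]
  simp [liftedVector]

variable [DecidableEq E] {M : Matroid E}

/-- The random subset of `B × [k]` lives on the first copies. -/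
theorem subsetExp_copies (B : Finset E) (g : Finset (E × Fin k) → ℝ) :
    subsetExp (copies k B) (liftedVector k x) g =
      subsetExp B (fun e => scaleParam k * x e) fun Q => g (Q ×ˢ {0}) := by
  have h : copies k B = B ×ˢ {0} ∪ copies k B \ B ×ˢ {0} :=
    (Finset.union_sdiff_of_subset (Finset.product_subset_product_right (by simp))).symm
  rw [h, subsetExp_union_of_eq_zero Finset.disjoint_sdiff]
  · simp only [Finset.product_singleton]
    rw [subsetExp_map]
    simp [liftedVector]
  · rintro ⟨e, i⟩ hi
    simp only [copies, Finset.mem_sdiff, Finset.mem_product, Finset.mem_univ, and_true,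
      Finset.mem_singleton, not_and] at hi
    exact if_neg (hi.2 hi.1)

/-- If all of `B` is protected, then `x` vanishes on `B`: otherwise, the rank `k ρ(B)` of `B × [k]`
would be less than the sum of `b x(B) ≤ b k ρ(B)`, which bounds the expected rank of the random set,
and of `(1 - b) k ρ(B)`, which bounds the increments of the rank. -/
theorem eq_zero_of_protect_eq (hx : x ∈ polytope (kFoldUnion M k)) {B : Finset E}
    (hB : protect M k (scaleParam k) (liftedVector k x) B = B) {e : E} (he : e ∈ B) : x e = 0 := by
  have hx0 := nonneg_of_mem_polytope hx
  have hx1 := le_one_of_mem_polytope hx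
  have hsum := sum_le_of_mem_polytope hx B
  have hrank : baseRank M B = 0 := by
    by_contra hne
    have h := (subsetExp_familyRank_protectStep_iterate (M := M) (b := scaleParam k) (B := B)
      (liftedVector_nonneg (k := k) hx0) (liftedVector_le_one hx0 hx1) B.card).2
    change baseRank M (protect M k (scaleParam k) (liftedVector k x) B) ≠ 0 →
      subsetExp (copies k B) (liftedVector k x) (fun R => (familyRank (extendedUnion M k)
        (R ∪ copies k (protect M k (scaleParam k) (liftedVector k x) B)) : ℝ)) <
      ∑ a ∈ copies k B, liftedVector k x a + (1 - scaleParam k) * k *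
        baseRank M (protect M k (scaleParam k) (liftedVector k x) B) at h
    rw [hB] at h
    have h' := h hne
    have hR : subsetExp (copies k B) (liftedVector k x) (fun R => (familyRank (extendedUnion M k)
        (R ∪ copies k B) : ℝ)) = k * baseRank M B := by
      refine (subsetExp_congr fun R hR => ?_).trans (subsetExp_const _)
      rw [Finset.union_eq_right.2 hR, familyRank_copies]
      push_cast
      rfl
    rw [hR, sum_liftedVector_copies] at h'
    have := mul_le_mul_of_nonneg_left hsum (scaleParam_nonneg k)
    nlinarith
  rw [hrank, Nat.cast_zero, mul_zero] at hsum
  have := Finset.single_le_sum (f := x) (fun a _ => hx0 a) he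
  exact le_antisymm (this.trans hsum) (hx0 e)

variable [Fintype E]

/-- Every element with `x e ≠ 0` lies in a layer of the chain. -/
theorem exists_mem_layer (hx : x ∈ polytope (kFoldUnion M k)) {e : E} (he : x e ≠ 0) :
    ∃ j, e ∈ chain M k (scaleParam k) (liftedVector k x) j \
      chain M k (scaleParam k) (liftedVector k x) (j + 1) := by
  by_contra! h
  have hmem : ∀ j, e ∈ chain M k (scaleParam k) (liftedVector k x) j := by
    intro j
    induction j with
    | zero => exact Finset.mem_univ e
    | succ j ih =>
      by_contra hj
      exact h j (Finset.mem_sdiff.2 ⟨ih, hj⟩)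
  have hcard : ∀ j, (chain M k (scaleParam k) (liftedVector k x) j).card + j ≤
      Fintype.card E := by
    intro j
    induction j with
    | zero => exact Finset.card_le_univ _
    | succ j ih =>
      have : (chain M k (scaleParam k) (liftedVector k x) (j + 1)).card <
          (chain M k (scaleParam k) (liftedVector k x) j).card :=
        Finset.card_lt_card (Finset.ssubset_iff_subset_ne.2 ⟨chain_succ_subset j,
          fun heq => he (eq_zero_of_protect_eq hx heq (hmem j))⟩)
      omega
  have := hcard (Fintype.card E + 1)
  omega

end chain

/-! ### Runs of an online scheme -/

namespace OnlineScheme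

variable {E : Type u} [DecidableEq E] {σ : OnlineScheme E} {ω : σ.Seed} {R : Finset E}

theorem runFrom_induction {P : Finset E → Prop}
    (hP : ∀ h A e, P A → e ∈ R → σ.rule ω h A e → P (insert e A)) (l : List E)
    (h : List (E × Bool)) {A : Finset E} (hA : P A) : P (σ.runFrom ω R l h A) := by
  induction l generalizing h A with
  | nil => exact hA
  | cons e l ih =>
    rw [runFrom]
    refine ih _ ?_
    split_ifs with he
    exacts [hP _ _ _ hA he.1 he.2, hA]

/-- If only elements of `Q` can be accepted and the rule accepts `e` whenever no elements outside
`Q \ {e}` were accepted before, then `e` is accepted in every order. -/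
theorem mem_runFrom {Q : Finset E} {e : E} (hQ : ∀ h A a, a ∈ R → σ.rule ω h A a → a ∈ Q)
    (he : e ∈ R) (hrule : ∀ h, ∀ A ⊆ Q.erase e, σ.rule ω h A e) (l : List E)
    (h : List (E × Bool)) {A : Finset E} (hA : A ⊆ Q.erase e) (hel : e ∈ l) :
    e ∈ σ.runFrom ω R l h A := by
  induction l generalizing h A with
  | nil => simp at hel
  | cons a l ih =>
    rw [runFrom]
    rcases eq_or_ne a e with rfl | hae
    · rw [if_pos ⟨he, hrule _ _ hA⟩]
      exact runFrom_induction (P := fun A => a ∈ A)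
        (fun _ _ _ hA _ _ => Finset.mem_insert_of_mem hA) _ _ (Finset.mem_insert_self _ _)
    · refine ih _ ?_ ((List.mem_cons.1 hel).resolve_left hae.symm)
      split_ifs with hacc
      · exact Finset.insert_subset (Finset.mem_erase.2 ⟨hae, hQ _ _ _ hacc.1 hacc.2⟩) hA
      · exact hA

end OnlineScheme

/-! ### Feasibility of the chain decomposition scheme -/

section feasible

variable {E : Type u} [Fintype E] [DecidableEq E] {M : Matroid E} {k : ℕ} [NeZero k]

/-- Suppose that `A` is covered by the layers of an antitone sequence `N`, and that in each layer
`A` is independent after contraction of the next set of the sequence. Then `A` is feasible. -/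
theorem mem_kFoldUnion_of_layers {N : ℕ → Finset E} (hN : Antitone N) (h0 : N 0 = Finset.univ)
    {A : Finset E} (hA : ∀ e ∈ A, ∃ j, e ∈ N j \ N (j + 1))
    (hr : ∀ j, (A ∩ (N j \ N (j + 1))).card +
        familyRank (extendedUnion M k) (copies k (N (j + 1))) ≤
      familyRank (extendedUnion M k)
        ((A ∩ (N j \ N (j + 1))) ×ˢ {(0 : Fin k)} ∪ copies k (N (j + 1)))) :
    A ∈ kFoldUnion M k := by
  have hstep : ∀ j, (A ∩ N (j + 1)).card ≤
        familyRank (extendedUnion M k) ((A ∩ N (j + 1)) ×ˢ {(0 : Fin k)}) →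
      (A ∩ N j).card ≤ familyRank (extendedUnion M k) ((A ∩ N j) ×ˢ {(0 : Fin k)}) := by
    intro j ih
    have hsplit : A ∩ N j = A ∩ N (j + 1) ∪ A ∩ (N j \ N (j + 1)) := by
      rw [← Finset.inter_union_distrib_left, Finset.union_sdiff_of_subset (hN j.le_succ)]
    have hsub : (A ∩ N (j + 1)) ×ˢ {(0 : Fin k)} ⊆ copies k (N (j + 1)) :=
      Finset.product_subset_product Finset.inter_subset_right (by simp)
    have h1 : familyRank (extendedUnion M k)
          (copies k (N (j + 1)) ∪ (A ∩ (N j \ N (j + 1))) ×ˢ {(0 : Fin k)}) +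
        familyRank (extendedUnion M k) ((A ∩ N (j + 1)) ×ˢ {(0 : Fin k)}) ≤
        familyRank (extendedUnion M k) ((A ∩ N (j + 1)) ×ˢ {(0 : Fin k)} ∪
          (A ∩ (N j \ N (j + 1))) ×ˢ {(0 : Fin k)}) +
        familyRank (extendedUnion M k) (copies k (N (j + 1))) :=
      familyRank_marginal_antitone hsub _
    have h2 := hr j
    rw [Finset.union_comm (copies k _), ← Finset.union_product, ← hsplit] at h1
    have h3 : (A ∩ N j).card ≤ (A ∩ N (j + 1)).card + (A ∩ (N j \ N (j + 1))).card := by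
      rw [hsplit]
      exact Finset.card_union_le _ _
    omega
  have hex : ∀ e, ∃ j, e ∈ A → e ∉ N j := fun e => by
    by_cases he : e ∈ A
    · obtain ⟨j, hj⟩ := hA e he
      exact ⟨j + 1, fun _ => (Finset.mem_sdiff.1 hj).2⟩
    · exact ⟨0, fun h => absurd h he⟩
  choose f hf using hex
  -- beyond the index `sup f`, the sequence avoids `A`
  have hJ : A ∩ N (Finset.univ.sup f) = ∅ := by
    refine Finset.eq_empty_of_forall_notMem fun e he => ?_
    rw [Finset.mem_inter] at he
    exact hf e he.1 (hN (Finset.le_sup (Finset.mem_univ e)) he.2)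
  have hall : ∀ J, (A ∩ N J).card ≤
        familyRank (extendedUnion M k) ((A ∩ N J) ×ˢ {(0 : Fin k)}) →
      (A ∩ N 0).card ≤ familyRank (extendedUnion M k) ((A ∩ N 0) ×ˢ {(0 : Fin k)}) := by
    intro J
    induction J with
    | zero => exact id
    | succ J ih => exact fun h => ih (hstep J h)
  have h := hall (Finset.univ.sup f) (by rw [hJ]; simp)
  rw [h0, Finset.inter_univ] at h
  have hmem : A ×ˢ {(0 : Fin k)} ∈ extendedUnion M k :=
    mem_of_card_le_familyRank (empty_mem_kFoldUnion _ _) (by simpa using h)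
  have := image_fst_mem_kFoldUnion hmem
  rwa [Finset.product_image_fst (Finset.singleton_nonempty _)] at this

theorem chainScheme_output_mem (x : E → ℝ) (K R : Finset E) (l : List E) :
    (chainScheme M k x).output K R l ∈ kFoldUnion M k := by
  set N := chain M k (scaleParam k) (liftedVector k x) with hNdef
  have hN : Antitone N := chain_antitone
  suffices h : (∀ e ∈ (chainScheme M k x).output K R l, ∃ j, e ∈ N j \ N (j + 1)) ∧
      ∀ j, ((chainScheme M k x).output K R l ∩ (N j \ N (j + 1))).card +
        familyRank (extendedUnion M k) (copies k (N (j + 1))) ≤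
      familyRank (extendedUnion M k) (((chainScheme M k x).output K R l ∩
        (N j \ N (j + 1))) ×ˢ {(0 : Fin k)} ∪ copies k (N (j + 1))) from
    mem_kFoldUnion_of_layers hN rfl h.1 h.2
  refine OnlineScheme.runFrom_induction (P := fun A => (∀ e ∈ A, ∃ j, e ∈ N j \ N (j + 1)) ∧
      ∀ j, (A ∩ (N j \ N (j + 1))).card +
        familyRank (extendedUnion M k) (copies k (N (j + 1))) ≤
      familyRank (extendedUnion M k) ((A ∩
        (N j \ N (j + 1))) ×ˢ {(0 : Fin k)} ∪ copies k (N (j + 1)))) ?_ _ _ (by simp)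
  rintro - A e ⟨hA1, hA2⟩ - ⟨-, j, hj, hspan⟩
  refine ⟨fun a ha => ?_, fun i => ?_⟩
  · rcases Finset.mem_insert.1 ha with rfl | ha
    exacts [⟨j, hj⟩, hA1 a ha]
  · by_cases hi : e ∈ N i \ N (i + 1)
    · -- the layers are disjoint
      have hij : i = j := by
        rw [Finset.mem_sdiff] at hi hj
        rcases lt_trichotomy i j with h | h | h
        · exact absurd (hN (Nat.succ_le_of_lt h) hj.1) hi.2
        · exact h
        · exact absurd (hN (Nat.succ_le_of_lt h) hi.1) hj.2
      subst hij
      rw [Finset.insert_inter_of_mem hi]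
      have hprod : insert e (A ∩ (N i \ N (i + 1))) ×ˢ {(0 : Fin k)} =
          insert (e, 0) ((A ∩ (N i \ N (i + 1))) ×ˢ {(0 : Fin k)}) := by
        ext ⟨a, i⟩
        simp only [Finset.mem_product, Finset.mem_insert, Finset.mem_singleton, Prod.mk.injEq]
        tauto
      rw [hprod, Finset.insert_union]
      have h1 := (familyRank_mono (𝓕 := extendedUnion M k) (Finset.subset_insert (e, (0 : Fin k))
        ((A ∩ (N i \ N (i + 1))) ×ˢ {(0 : Fin k)} ∪ copies k (N (i + 1))))).lt_of_ne hspan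
      have h2 := hA2 i
      have h3 := Finset.card_insert_le e (A ∩ (N i \ N (i + 1)))
      omega
    · rw [Finset.insert_inter_of_notMem hi]
      exact hA2 i

/-- The chain decomposition scheme as an online contention resolution scheme. -/
noncomputable def chainOCRS (M : Matroid E) (k : ℕ) [NeZero k] : OCRS (kFoldUnion M k) where
  scheme x := chainScheme M k x
  feasible x ω R l _ := chainScheme_output_mem (x : E → ℝ) ω R l

end feasible

/-! ### Selectability -/

theorem le_keepProb_mul {k : ℕ} (hk : 2 ≤ k) :
    1 - 3 * Real.sqrt (Real.log k / k) ≤ keepProb k * (1 - 1 / k) := by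
  have hk2 : (2 : ℝ) ≤ k := by exact_mod_cast hk
  have hb0 := scaleParam_nonneg k
  have hs : 1 - scaleParam k = Real.sqrt (Real.log k / k) := by rw [scaleParam, sub_sub_cancel]
  rw [keepProb, hs]
  have hb : scaleParam k = 1 - Real.sqrt (Real.log k / k) := rfl
  rw [hb] at hb0 ⊢
  set s := Real.sqrt (Real.log k / k) with hsdef
  have hs0 : 0 ≤ s := Real.sqrt_nonneg _
  have hk1 : 1 / (k : ℝ) ≤ s := by
    refine Real.le_sqrt_of_sq_le ?_
    have hlog : 1 / (k : ℝ) ≤ Real.log k := by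
      have h1 : Real.log 2 ≤ Real.log k := Real.log_le_log two_pos hk2
      have h2 : 1 / (k : ℝ) ≤ 1 / 2 := one_div_le_one_div_of_le two_pos hk2
      have := Real.log_two_gt_d9
      linarith
    rw [sq, div_eq_mul_one_div (Real.log k)]
    exact mul_le_mul_of_nonneg_right hlog (by positivity)
  have hexp : 1 - s ≤ Real.exp (-s) := by linarith [Real.add_one_le_exp (-s)]
  calc 1 - 3 * s ≤ (1 - s) * (1 - s) * (1 - s) := by nlinarith [mul_nonneg hs0 hs0]
    _ ≤ (1 - s) * Real.exp (-s) * (1 - 1 / k) := by gcongr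

section selectable

variable {E : Type u} [DecidableEq E] {M : Matroid E} {k : ℕ} [NeZero k]

/-- The occupancy of `e` after the contraction of `N' × [k]`, as a function of a subset of `N`. -/
noncomputable def layerOcc (M : Matroid E) (k : ℕ) [NeZero k] (N N' : Finset E) (e : E)
    (Q : Finset E) : ℝ :=
  occ M k e ((Q ∩ N) ×ˢ {(0 : Fin k)} ∪ copies k N')

theorem layerOcc_mono {N N' : Finset E} {e : E} {Q Q' : Finset E} (h : Q ⊆ Q') :
    layerOcc M k N N' e Q ≤ layerOcc M k N N' e Q' :=
  occ_mono e (Finset.union_subset_union_left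
    (Finset.product_subset_product_left (Finset.inter_subset_inter_right h)))

theorem layerOcc_insert_le {N N' : Finset E} {e : E} (a : E) (Q : Finset E) :
    layerOcc M k N N' e (insert a Q) ≤ layerOcc M k N N' e Q + 1 := by
  unfold layerOcc
  refine le_trans (occ_mono e ?_) (occ_insert_le e (a, 0) _)
  rintro ⟨b, i⟩ hb
  simp only [Finset.mem_union, Finset.mem_product, Finset.mem_inter, Finset.mem_insert,
    Finset.mem_singleton, Prod.mk.injEq] at hb ⊢
  tauto

variable [Fintype E]

/-- An active kept element `e` of a layer is accepted in every arrival order unless the other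
active kept elements of the layer fully occupy it. -/
theorem mem_chainScheme_output {x : E → ℝ} {K R : Finset E} {e : E} {j : ℕ} {l : List E}
    (hl : e ∈ l) (he : e ∈ R ∩ K)
    (hj : e ∈ chain M k (scaleParam k) (liftedVector k x) j \
      chain M k (scaleParam k) (liftedVector k x) (j + 1))
    (hocc : layerOcc M k (chain M k (scaleParam k) (liftedVector k x) j)
      (chain M k (scaleParam k) (liftedVector k x) (j + 1)) e ((R ∩ K).erase e) < k) :
    e ∈ (chainScheme M k x).output K R l := by
  refine OnlineScheme.mem_runFrom (σ := chainScheme M k x) (ω := K) (Q := R ∩ K)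
    (fun _ _ a ha hrule => Finset.mem_inter.2 ⟨ha, hrule.1⟩) (Finset.mem_inter.1 he).1
    (fun _ A hA => ⟨(Finset.mem_inter.1 he).2, j, hj, fun hspan => ?_⟩) l []
    (Finset.empty_subset _) hl
  refine hocc.not_ge ?_
  rw [← occ_eq_of_inSpan (fun i hi => ?_) hspan]
  · refine occ_mono e (Finset.union_subset_union_left (Finset.product_subset_product_left ?_))
    exact Finset.inter_subset_inter hA Finset.sdiff_subset
  · rcases Finset.mem_union.1 hi with hi | hi
    · have := hA (Finset.mem_inter.1 (Finset.mem_product.1 hi).1).1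
      simp at this
    · exact (Finset.mem_sdiff.1 hj).2 (mem_copies.1 hi)

/-- An unprotected element is fully occupied by the thinned random set with probability at most
`1 / k`. -/
theorem subsetExp_layerOcc_le (hk : 2 ≤ k) {x : E → ℝ} (hx0 : ∀ e, 0 ≤ x e) (hx1 : ∀ e, x e ≤ 1)
    {N : Finset E} {e : E}
    (he : e ∈ N \ protect M k (scaleParam k) (liftedVector k x) N) :
    subsetExp Finset.univ (fun a => x a * keepProb k)
      (fun Q => if (k : ℝ) ≤ layerOcc M k N (protect M k (scaleParam k) (liftedVector k x) N) e Q
        then 1 else 0) ≤ 1 / k := by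
  have hk0 : (0 : ℝ) < k := by positivity
  have hq : (fun a => x a * keepProb k) =
      fun a => Real.exp (-(1 - scaleParam k)) * (scaleParam k * x a) := by
    funext a
    rw [keepProb]
    ring
  have hexp : subsetExp Finset.univ (fun a => scaleParam k * x a)
      (layerOcc M k N (protect M k (scaleParam k) (liftedVector k x) N) e) ≤ scaleParam k * k := by
    refine le_of_eq_of_le ?_ (expectedOcc_protect_le he)
    refine (subsetExp_of_subset (g := fun Q => occ M k e (Q ×ˢ {(0 : Fin k)} ∪
      copies k (protect M k (scaleParam k) (liftedVector k x) N))) (Finset.subset_univ N)).trans ?_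
    exact (subsetExp_copies N fun R => occ M k e (R ∪
      copies k (protect M k (scaleParam k) (liftedVector k x) N))).symm
  have h := subsetExp_tail_le (N := Finset.univ) (p := fun a => scaleParam k * x a)
    (l := 1 - scaleParam k) (c := k)
    (f := layerOcc M k N (protect M k (scaleParam k) (liftedVector k x) N) e)
    (sub_nonneg.2 (scaleParam_le_one k)) (fun a => mul_nonneg (scaleParam_nonneg k) (hx0 a))
    (fun a => mul_le_one₀ (scaleParam_le_one k) (hx0 a) (hx1 a))
    (fun a S => layerOcc_mono (Finset.subset_insert a S)) layerOcc_insert_le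
  have hs : (1 - scaleParam k) * (scaleParam k * k - k) = -Real.log k := by
    have h1 : (1 - scaleParam k) ^ 2 = Real.log k / k := by
      rw [scaleParam, sub_sub_cancel, Real.sq_sqrt]
      exact div_nonneg (Real.log_natCast_nonneg k) hk0.le
    calc _ = -((1 - scaleParam k) ^ 2 * k) := by ring
      _ = -Real.log k := by rw [h1, div_mul_cancel₀ _ hk0.ne']
  rw [hq]
  calc _ ≤ _ := h
    _ ≤ Real.exp ((1 - scaleParam k) * (scaleParam k * k - k)) :=
        Real.exp_le_exp.2 (mul_le_mul_of_nonneg_left (sub_le_sub_right hexp _)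
          (sub_nonneg.2 (scaleParam_le_one k)))
    _ = 1 / k := by rw [hs, Real.exp_neg, Real.exp_log hk0, one_div]

theorem keepProb_mul_le_acceptProb (hk : 2 ≤ k) {x : E → ℝ} (hx : x ∈ polytope (kFoldUnion M k))
    (𝒜 : AlmightyAdversary (chainScheme M k x)) (e : E) :
    x e * keepProb k * (1 - 1 / k) ≤ (chainScheme M k x).acceptProb x 𝒜 e := by
  have hx0 := nonneg_of_mem_polytope hx
  have hx1 := le_one_of_mem_polytope hx
  have hacc : (chainScheme M k x).acceptProb x 𝒜 e =
      subsetExp Finset.univ x fun R => subsetExp Finset.univ (fun _ => keepProb k) fun K =>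
        if e ∈ (chainScheme M k x).output K R (𝒜.order R K) then 1 else 0 := by
    simp only [OnlineScheme.acceptProb, subsetExp, Finset.powerset_univ, Finset.mul_sum]
    refine Finset.sum_congr rfl fun R _ => ?_
    exact Finset.sum_congr rfl fun K _ => mul_assoc _ _ _
  rw [hacc]
  by_cases hxe : x e = 0
  · rw [hxe, zero_mul, zero_mul]
    refine subsetExp_nonneg hx0 hx1 fun R => ?_
    refine subsetExp_nonneg (fun _ => keepProb_nonneg k) (fun _ => keepProb_le_one k) fun K => ?_
    split_ifs <;> norm_num
  obtain ⟨j, hj⟩ := exists_mem_layer hx hxe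
  set f := layerOcc M k (chain M k (scaleParam k) (liftedVector k x) j)
    (chain M k (scaleParam k) (liftedVector k x) (j + 1)) e with hf
  have hq0 : ∀ a, 0 ≤ x a * keepProb k := fun a => mul_nonneg (hx0 a) (keepProb_nonneg k)
  have hq1 : ∀ a, x a * keepProb k ≤ 1 := fun a =>
    mul_le_one₀ (hx1 a) (keepProb_nonneg k) (keepProb_le_one k)
  calc x e * keepProb k * (1 - 1 / k)
      ≤ x e * keepProb k * subsetExp Finset.univ (fun a => x a * keepProb k)
          (fun Q => 1 - if (k : ℝ) ≤ f Q then 1 else 0) := by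
        refine mul_le_mul_of_nonneg_left ?_ (hq0 e)
        rw [subsetExp_sub, subsetExp_const]
        exact sub_le_sub_left (subsetExp_layerOcc_le hk hx0 hx1 hj) _
    _ ≤ x e * keepProb k * subsetExp Finset.univ (fun a => x a * keepProb k)
          (fun Q => if f (Q.erase e) < k then 1 else 0) := by
        refine mul_le_mul_of_nonneg_left (subsetExp_mono hq0 hq1 fun Q _ => ?_) (hq0 e)
        have hmono : f (Q.erase e) ≤ f Q := layerOcc_mono (Finset.erase_subset e Q)
        split_ifs with h1 h2 h2 <;> try norm_num
        exact h2 (hmono.trans_lt (not_le.1 h1))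
    _ = subsetExp Finset.univ (fun a => x a * keepProb k)
          (fun Q => if e ∈ Q then (if f (Q.erase e) < k then 1 else 0) else 0) :=
        (subsetExp_mem_erase (p := fun a => x a * keepProb k)
          (g := fun Q => if f Q < k then 1 else 0) (Finset.mem_univ e)).symm
    _ = subsetExp Finset.univ x (fun R => subsetExp Finset.univ (fun _ => keepProb k) fun K =>
          if e ∈ R ∩ K then (if f ((R ∩ K).erase e) < k then 1 else 0) else 0) :=
        (subsetExp_inter (q := fun _ => keepProb k)
          (g := fun Q => if e ∈ Q then (if f (Q.erase e) < k then 1 else 0) else 0)).symm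
    _ ≤ _ := by
        refine subsetExp_mono hx0 hx1 fun R _ => ?_
        refine subsetExp_mono (fun _ => keepProb_nonneg k) (fun _ => keepProb_le_one k)
          fun K _ => ?_
        by_cases h : e ∈ R ∩ K ∧ f ((R ∩ K).erase e) < k
        · rw [if_pos h.1, if_pos h.2,
            if_pos (mem_chainScheme_output ((𝒜.isArrivalOrder R K).2 e) h.1 hj h.2)]
        · rw [not_and] at h
          have h0 : (if e ∈ R ∩ K then (if f ((R ∩ K).erase e) < k then (1 : ℝ) else 0) else 0) =
              0 := by
            split_ifs with h1 h2
            exacts [absurd h2 (h h1), rfl, rfl]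
          rw [h0]
          split_ifs <;> norm_num

end selectable

/-- The `k`-fold union of a matroid `M` has a `(1 - O(√(log k / k)))`-selectable OCRS against the
almighty adversary, given by the chain decomposition scheme. -/
theorem mainTheorem1 :
    ∃ C : ℝ, 0 < C ∧ ∀ (k : ℕ) [NeZero k], 2 ≤ k →
      ∀ (E : Type u) [Fintype E] [DecidableEq E] (M : Matroid E), M.E = Set.univ →
        ∃ S : OCRS (kFoldUnion M k),
          (∀ x : polytope (kFoldUnion M k), S.scheme x = chainScheme M k x) ∧
          S.IsSelectable (1 - C * Real.sqrt (Real.log k / k)) := by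
  refine ⟨3, by norm_num, fun k _ hk E _ _ M _ => ⟨chainOCRS M k, fun x => rfl, fun x 𝒜 e => ?_⟩⟩
  refine le_trans ?_ (keepProb_mul_le_acceptProb hk x.2 𝒜 e)
  rw [mul_assoc, mul_comm]
  exact mul_le_mul_of_nonneg_left (le_keepProb_mul hk) (nonneg_of_mem_polytope x.2 e)
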